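/- Let $n\ge 2$ and let $P\colon\mathbb{C}^n\to\mathbb{R}$ be a polynomial function (that is, a polynomial in $z_1,\dots,z_n,\overline{z_1},\dots,\overline{z_n}$ with complex coefficients that takes only real values) which is homogeneous over $\mathbb{R}$, i.e. for some integer $d\ge 0$ all its terms $a_{\alpha,\beta}z^\alpha\overline{z}^\beta$ satisfy $|\alpha|+|\beta|=d$. Assume that $P$ is plurisubharmonic and not pluriharmonic. Then there are at most finitely many complex hyperplanes $H$ through the origin in $\mathbb{C}^n$ (complex linear subspaces of dimension $n-1$) along which $P$ is pluriharmonic, that is, such that the restriction $P|_H$ is a pluriharmonic function on $H$. (Here a real-valued function is pluriharmonic if it is $C^2$ and its restriction to every complex affine line is harmonic; for $n=2$ the hyperplanes are the complex lines through the origin, and pluriharmonic along $H$ means harmonic along $H$.) -/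

import Mathlib

/-- A function `P : ℂⁿ → ℝ` is a polynomial function, homogeneous of degree `d` over `ℝ`: it is a
polynomial in `z₁, …, zₙ` and their conjugates with complex coefficients (equivalently, a real
polynomial in the real and imaginary parts of the coordinates), all of whose terms
`a_{α,β} z^α (conj z)^β` satisfy `|α| + |β| = d`. The variable `Sum.inl j` stands for `z_j` and
`Sum.inr j` for the conjugate of `z_j`. -/
def IsHomogeneousPolynomialFun {n : ℕ} (d : ℕ) (P : (Fin n → ℂ) → ℝ) : Prop :=
  ∃ p : MvPolynomial (Fin n ⊕ Fin n) ℂ, p.IsHomogeneous d ∧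
    ∀ z : Fin n → ℂ,
      (P z : ℂ) = MvPolynomial.eval (Sum.elim z (fun j => (starRingEnd ℂ) (z j))) p

/-- Plurisubharmonicity of a (finite-valued) function on a complex normed space: upper
semicontinuity together with the sub-mean value inequality on every circle in every complex
affine line. The vector `b` carries both the direction of the line and the radius. -/
structure IsPlurisubharmonic {E : Type*} [NormedAddCommGroup E] [NormedSpace ℂ E]
    (u : E → ℝ) : Prop where
  upperSemicontinuous : UpperSemicontinuous u
  circleIntegrable : ∀ a b : E, CircleIntegrable (fun ζ : ℂ => u (a + ζ • b)) 0 1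
  le_circleAverage : ∀ a b : E, u a ≤ Real.circleAverage (fun ζ : ℂ => u (a + ζ • b)) 0 1

/-- Pluriharmonicity of a function on a complex normed space: it is twice continuously
differentiable over `ℝ` and harmonic on every complex affine line. -/
structure IsPluriharmonic {E : Type*} [NormedAddCommGroup E] [NormedSpace ℂ E]
    (u : E → ℝ) : Prop where
  contDiff : ContDiff ℝ 2 u
  harmonic_line : ∀ a b : E,
    InnerProductSpace.HarmonicOnNhd (fun ζ : ℂ => u (a + ζ • b)) Set.univ

/-- Pluriharmonicity along a complex linear subspace `H`: the restriction of the function to `H`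
is pluriharmonic. On a complex line this is harmonicity. -/
def IsPluriharmonicAlong {E : Type*} [NormedAddCommGroup E] [NormedSpace ℂ E]
    (u : E → ℝ) (H : Submodule ℂ E) : Prop :=
  IsPluriharmonic (fun z : H => u (z : E))

open Filter Topology

/-! Let U be the average of P over the rotations z ↦ ζz, |ζ| = 1. Then U ≥ 0, U(cz) = |c|^d U(z),
and U is locally Lipschitz and satisfies the sub-mean value inequality on complex lines
(`isHomogeneousSubmean_rotationAverage`). If P is pluriharmonic along H, the mean value property at
the origin makes U vanish on H.

U is not identically zero. Otherwise averaging the sub-mean inequality over rotations forces P(w) to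
equal the mean of P(w + ζw). On the part of P of bidegree (a, d - a) that mean acts as
multiplication by the binomial coefficient of d over a, so only the holomorphic and antiholomorphic
parts survive and P is pluriharmonic
(`IsHomogeneousPolynomialFun.isPluriharmonic_of_circleAverage_eq`).

If U vanished on 2d + 2 hyperplanes, restriction to a suitable plane would give V ≢ 0 on ℂ²
vanishing on 2d + 2 distinct lines. With Q the product of their linear forms, V²‖z‖²/|Q| is
homogeneous of degree 0 and attains a maximum at some p. The strict growth of ‖z‖² transversally to
p then makes V too small on a small circle around p in a well-chosen line, against the sub-mean
inequality (`IsHomogeneousSubmean.eq_zero`). -/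

/-! ### Circle means of the modulus of a holomorphic function. -/

theorem Complex.norm_le_re_add_im_sq {z : ℂ} (hz : 1 / 2 ≤ z.re) : ‖z‖ ≤ z.re + z.im ^ 2 := by
  rw [Complex.norm_eq_sqrt_sq_add_sq]
  apply Real.sqrt_le_iff.2
  constructor
  · positivity
  · nlinarith [sq_nonneg z.im, sq_nonneg (z.im ^ 2)]

/-- Re G has mean exactly 1, and Im G = o(r) because G'(0) = 0, so |G| ≤ Re G + (Im G)² costs only
o(r²). A nonzero G'(0) would contribute a term of order r². -/
theorem eventually_circleAverage_norm_le {G : ℂ → ℂ} {R δ : ℝ} (hR : 0 < R) (hδ : 0 < δ)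
    (hG : DifferentiableOn ℂ G (Metric.ball 0 R)) (h0 : G 0 = 1) (h1 : HasDerivAt G 0 0) :
    ∀ᶠ r : ℝ in 𝓝[>] 0, Real.circleAverage (fun ζ => ‖G ζ‖) 0 r ≤ 1 + δ * r ^ 2 := by
  have hsmall : ∀ᶠ ζ in 𝓝 (0 : ℂ), ‖G ζ - 1‖ ^ 2 ≤ δ * ‖ζ‖ ^ 2 ∧ ‖G ζ - 1‖ ≤ 1 / 2 := by
    have h2 := h1.isLittleO.def (Real.sqrt_pos.2 hδ)
    have h3 : ∀ᶠ ζ in 𝓝 (0 : ℂ), ‖G ζ - 1‖ < 1 / 2 := by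
      have := (h1.continuousAt.sub_const 1).norm
      have h4 : ‖G 0 - 1‖ < 1 / 2 := by simp [h0]
      exact this.eventually (gt_mem_nhds h4)
    filter_upwards [h2, h3] with ζ h2 h3
    refine ⟨?_, h3.le⟩
    simp only [h0, sub_zero, smul_zero] at h2
    calc ‖G ζ - 1‖ ^ 2 ≤ (√δ * ‖ζ‖) ^ 2 := by gcongr
      _ = δ * ‖ζ‖ ^ 2 := by rw [mul_pow, Real.sq_sqrt hδ.le]
  obtain ⟨ρ, hρ, hball⟩ := Metric.eventually_nhds_iff_ball.1 hsmall
  have : Set.Ioo 0 (min ρ R) ∈ 𝓝[>] (0 : ℝ) := Ioo_mem_nhdsGT (lt_min hρ hR)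
  filter_upwards [this] with r hr
  have hrR : Metric.closedBall (0 : ℂ) |r| ⊆ Metric.ball 0 R := by
    apply Metric.closedBall_subset_ball
    rw [abs_of_pos hr.1]; exact hr.2.trans_le (min_le_right _ _)
  have hsph : Metric.sphere (0 : ℂ) |r| ⊆ Metric.ball 0 R := Metric.sphere_subset_closedBall.trans hrR
  have hcont : ContinuousOn G (Metric.sphere (0 : ℂ) |r|) := hG.continuousOn.mono hsph
  have hmean : Real.circleAverage G 0 r = 1 := by
    rw [← h0]
    apply circleAverage_of_differentiable_on_off_countable Set.countable_empty
    · exact hG.continuousOn.mono hrR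
    · intro z hz
      exact hG.differentiableAt (Metric.isOpen_ball.mem_nhds (hrR (Metric.ball_subset_closedBall hz.1)))
  have hint : CircleIntegrable G 0 r := hcont.circleIntegrable'
  have hre : Real.circleAverage (fun ζ => (G ζ).re) 0 r = 1 := by
    have := Complex.reCLM.circleAverage_comp_comm hint
    rw [hmean] at this
    exact this
  have hre_int : CircleIntegrable (fun ζ => (G ζ).re) 0 r :=
    (Complex.continuous_re.comp_continuousOn hcont).circleIntegrable'
  have hconst : CircleIntegrable (fun _ : ℂ => δ * r ^ 2) 0 r := circleIntegrable_const _ _ _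
  calc Real.circleAverage (fun ζ => ‖G ζ‖) 0 r
      ≤ Real.circleAverage (fun ζ => (G ζ).re + δ * r ^ 2) 0 r := by
        apply Real.circleAverage_mono hcont.norm.circleIntegrable' (hre_int.add hconst)
        intro ζ hζ
        have hζr : ‖ζ‖ = r := by simpa [abs_of_pos hr.1] using hζ
        have hζρ : ζ ∈ Metric.ball (0 : ℂ) ρ := by
          simpa [hζr] using hr.2.trans_le (min_le_left _ _)
        obtain ⟨h3, h4⟩ := hball ζ hζρ
        rw [hζr] at h3
        have h5 := (Complex.abs_re_le_norm (G ζ - 1)).trans h4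
        have h6 := Complex.abs_im_le_norm (G ζ - 1)
        simp only [Complex.sub_re, Complex.one_re, Complex.sub_im, Complex.one_im, sub_zero] at h5 h6
        have h7 : (G ζ).im ^ 2 ≤ ‖G ζ - 1‖ ^ 2 := sq_le_sq.2 (by simpa using h6)
        have h8 := Complex.norm_le_re_add_im_sq (z := G ζ) (by linarith [(abs_le.1 h5).1])
        change ‖G ζ‖ ≤ (G ζ).re + δ * r ^ 2
        linarith
    _ = 1 + δ * r ^ 2 := by
        rw [Real.circleAverage_fun_add hre_int hconst, hre, Real.circleAverage_const]

/-! ### Submean functions homogeneous in the modulus. -/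

/-- A nonnegative function `V` with the properties of the restriction to a complex plane of a
plurisubharmonic function that is homogeneous of degree `d` in the modulus. -/
structure IsHomogeneousSubmean {E : Type*} [NormedAddCommGroup E] [NormedSpace ℂ E]
    (d : ℕ) (V : E → ℝ) : Prop where
  nonneg : ∀ z, 0 ≤ V z
  smul : ∀ (c : ℂ) z, V (c • z) = ‖c‖ ^ d * V z
  le_circleAverage : ∀ a b : E, V a ≤ Real.circleAverage (fun ζ : ℂ => V (a + ζ • b)) 0 1
  lipschitz : ∀ R : ℝ, ∃ L : ℝ, 0 ≤ L ∧ ∀ z w : E, ‖z‖ ≤ R → ‖w‖ ≤ R → |V z - V w| ≤ L * ‖z - w‖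

namespace IsHomogeneousSubmean

variable {E : Type*} [NormedAddCommGroup E] [NormedSpace ℂ E] {d : ℕ} {V : E → ℝ}

theorem continuous (hV : IsHomogeneousSubmean d V) : Continuous V := by
  rw [continuous_iff_continuousAt]
  intro z
  obtain ⟨L, -, hL⟩ := hV.lipschitz (‖z‖ + 1)
  rw [ContinuousAt, tendsto_iff_dist_tendsto_zero]
  have h1 : Tendsto (fun w => L * ‖w - z‖) (𝓝 z) (𝓝 0) := by
    have : Continuous fun w => L * ‖w - z‖ := by fun_prop
    simpa using this.tendsto z
  refine squeeze_zero' (Eventually.of_forall fun _ => dist_nonneg) ?_ h1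
  filter_upwards [Metric.ball_mem_nhds z one_pos] with w hw
  rw [Real.dist_eq]
  apply hL _ _ _ (by linarith)
  have := norm_le_norm_add_norm_sub' w z
  rw [mem_ball_iff_norm] at hw
  linarith

theorem map_zero (hV : IsHomogeneousSubmean d V) (hd : d ≠ 0) : V 0 = 0 := by
  simpa [hd] using hV.smul 0 0

/-- Restriction along a linear map from `ℂ × ℂ`. -/
theorem comp_prod (hV : IsHomogeneousSubmean d V) (x y : E) :
    IsHomogeneousSubmean d (fun z : ℂ × ℂ => V (z.1 • x + z.2 • y)) where
  nonneg _ := hV.nonneg _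
  smul c z := by
    rw [← hV.smul]; congr 1; simp [smul_smul]
  le_circleAverage a b := by
    refine (hV.le_circleAverage _ (b.1 • x + b.2 • y)).trans_eq ?_
    congr 1; ext ζ; congr 1
    simp only [Prod.fst_add, Prod.snd_add, Prod.smul_fst, Prod.smul_snd, smul_eq_mul]
    module
  lipschitz R := by
    obtain ⟨L, hL0, hL⟩ := hV.lipschitz (R * ‖x‖ + R * ‖y‖)
    have key (z : ℂ × ℂ) : ‖z.1 • x + z.2 • y‖ ≤ ‖z‖ * ‖x‖ + ‖z‖ * ‖y‖ := by
      refine (norm_add_le _ _).trans ?_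
      rw [norm_smul, norm_smul]
      gcongr
      · exact norm_fst_le z
      · exact norm_snd_le z
    refine ⟨L * (‖x‖ + ‖y‖), by positivity, fun z w hz hw => ?_⟩
    have bound (z : ℂ × ℂ) (hz : ‖z‖ ≤ R) : ‖z.1 • x + z.2 • y‖ ≤ R * ‖x‖ + R * ‖y‖ :=
      (key z).trans (by gcongr)
    refine (hL _ _ (bound z hz) (bound w hw)).trans ?_
    have : z.1 • x + z.2 • y - (w.1 • x + w.2 • y) = (z - w).1 • x + (z - w).2 • y := by
      simp only [Prod.fst_sub, Prod.snd_sub]; module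
    rw [this, mul_assoc]
    gcongr
    linarith [key (z - w)]

end IsHomogeneousSubmean

/-! ### The extremal point of V²‖z‖²/|Q| on ℂ². -/

section Extremal

variable {d : ℕ} {V : ℂ × ℂ → ℝ} {S : Finset ℂ}

/-- Away from the origin at most one factor vanishes at a point. There the Lipschitz bound gives V =
O(|z₁ + s z₂|), so V² beats the simple zero; this is why V is squared. Division by zero yields 0,
which is the correct limit. -/
theorem continuousOn_sq_div_prod (hV : IsHomogeneousSubmean d V)
    (hS : ∀ s ∈ S, ∀ b : ℂ, V (-s * b, b) = 0) :
    ContinuousOn (fun z : ℂ × ℂ => V z ^ 2 / ‖∏ s ∈ S, (z.1 + s * z.2)‖) {0}ᶜ := by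
  intro p hp
  apply ContinuousAt.continuousWithinAt
  have hVc := hV.continuous
  by_cases hQ : ∏ s ∈ S, (p.1 + s * p.2) = 0
  swap
  · refine ContinuousAt.div (by fun_prop) (by fun_prop) (norm_ne_zero_iff.2 hQ)
  obtain ⟨s, hs, hs0⟩ := Finset.prod_eq_zero_iff.1 hQ
  have hne : ∏ t ∈ S.erase s, (p.1 + t * p.2) ≠ 0 := by
    rw [Finset.prod_ne_zero_iff]
    intro t ht ht0
    have h1 : (t - s) * p.2 = 0 := by linear_combination ht0 - hs0
    have h2 : p.2 = 0 := (mul_eq_zero.1 h1).resolve_left (sub_ne_zero.2 (Finset.ne_of_mem_erase ht))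
    have h3 : p.1 = 0 := by simpa [h2] using hs0
    exact hp (Prod.ext h3 h2)
  obtain ⟨L, hL0, hL⟩ := hV.lipschitz ((1 + ‖s‖) * (‖p‖ + 1))
  have hnear : ∀ᶠ z in 𝓝 p, V z ^ 2 / ‖∏ s ∈ S, (z.1 + s * z.2)‖ ≤
      L ^ 2 * ‖z.1 + s * z.2‖ / ‖∏ t ∈ S.erase s, (z.1 + t * z.2)‖ := by
    filter_upwards [Metric.ball_mem_nhds p one_pos] with z hz
    have hz1 : ‖z‖ ≤ ‖p‖ + 1 := by
      have := norm_le_norm_add_norm_sub' z p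
      rw [mem_ball_iff_norm] at hz
      linarith
    have hz2 : ‖z‖ ≤ (1 + ‖s‖) * (‖p‖ + 1) := by
      refine hz1.trans ?_
      nlinarith [norm_nonneg s, norm_nonneg p]
    have hz3 : ‖((-s * z.2, z.2) : ℂ × ℂ)‖ ≤ (1 + ‖s‖) * (‖p‖ + 1) := by
      have h4 := (norm_snd_le z).trans hz1
      rw [Prod.norm_mk, max_le_iff, norm_mul, norm_neg]
      constructor
      · gcongr; linarith
      · exact h4.trans (by nlinarith [norm_nonneg s, norm_nonneg p])
    have h5 := hL z (-s * z.2, z.2) hz2 hz3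
    have h6 : z - (-s * z.2, z.2) = (z.1 + s * z.2, 0) := by ext <;> simp
    rw [hS s hs, sub_zero, abs_of_nonneg (hV.nonneg z), h6, Prod.norm_mk, norm_zero,
      max_eq_left (norm_nonneg _)] at h5
    rw [← Finset.mul_prod_erase S _ hs, norm_mul]
    rcases eq_or_ne ‖z.1 + s * z.2‖ 0 with h7 | h7
    · simp [h7]
    · have h8 : V z ^ 2 ≤ (L * ‖z.1 + s * z.2‖) ^ 2 := pow_le_pow_left₀ (hV.nonneg z) h5 2
      rw [← div_div]
      gcongr
      rw [div_le_iff₀ (by positivity)]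
      linarith
  have hlim : Tendsto (fun z : ℂ × ℂ =>
      L ^ 2 * ‖z.1 + s * z.2‖ / ‖∏ t ∈ S.erase s, (z.1 + t * z.2)‖) (𝓝 p) (𝓝 0) := by
    have : ContinuousAt (fun z : ℂ × ℂ =>
      L ^ 2 * ‖z.1 + s * z.2‖ / ‖∏ t ∈ S.erase s, (z.1 + t * z.2)‖) p :=
      ContinuousAt.div (by fun_prop) (by fun_prop) (norm_ne_zero_iff.2 hne)
    simpa [ContinuousAt, hs0] using this
  have := squeeze_zero' (Eventually.of_forall fun z => by positivity) hnear hlim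
  simpa [ContinuousAt, hQ] using this

/-- The quotient has degree 2d + 2 - #S = 0, so its maximum on the unit sphere is global.
Cross-multiplying includes the zeros of Q. The Euclidean norm is written out because ℂ × ℂ carries
the sup norm. -/
theorem exists_max_sq_div_prod (hV : IsHomogeneousSubmean d V) (hd : d ≠ 0)
    (hcard : S.card = 2 * d + 2) (hS : ∀ s ∈ S, ∀ b : ℂ, V (-s * b, b) = 0) (hne : ∃ z, V z ≠ 0) :
    ∃ p : ℂ × ℂ, ‖p.1‖ ^ 2 + ‖p.2‖ ^ 2 = 1 ∧ 0 < V p ∧ (∀ s ∈ S, p.1 + s * p.2 ≠ 0) ∧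
      ∀ z : ℂ × ℂ, V z ^ 2 * (‖z.1‖ ^ 2 + ‖z.2‖ ^ 2) * ‖∏ s ∈ S, (p.1 + s * p.2)‖ ≤
        V p ^ 2 * ‖∏ s ∈ S, (z.1 + s * z.2)‖ := by
  set Q : ℂ × ℂ → ℂ := fun z => ∏ s ∈ S, (z.1 + s * z.2) with hQ
  set K : Set (ℂ × ℂ) := {z | ‖z.1‖ ^ 2 + ‖z.2‖ ^ 2 = 1} with hK
  have hKcpt : IsCompact K := by
    apply Metric.isCompact_of_isClosed_isBounded
    · exact isClosed_eq (by fun_prop) (by fun_prop)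
    · apply (Metric.isBounded_closedBall (x := (0 : ℂ × ℂ)) (r := 1)).subset
      intro z hz
      have hz : ‖z.1‖ ^ 2 + ‖z.2‖ ^ 2 = 1 := hz
      rw [mem_closedBall_zero_iff, Prod.norm_def, max_le_iff]
      constructor <;> nlinarith [norm_nonneg z.1, norm_nonneg z.2]
  have hVQ (z : ℂ × ℂ) (hz : Q z = 0) : V z = 0 := by
    obtain ⟨s, hs, h⟩ := Finset.prod_eq_zero_iff.1 hz
    rw [← hS s hs z.2]
    congr 1
    exact Prod.ext (by linear_combination h) rfl
  have hQsmul (c : ℂ) (z : ℂ × ℂ) : Q (c • z) = c ^ (2 * d + 2) * Q z := by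
    simp only [hQ, ← hcard, ← Finset.prod_const, ← Finset.prod_mul_distrib, Prod.smul_fst,
      Prod.smul_snd, smul_eq_mul]
    exact Finset.prod_congr rfl fun s _ => by ring
  have hnorm (z : ℂ × ℂ) (hz : z ≠ 0) : ∃ (t : ℝ) (u : ℂ × ℂ), 0 < t ∧ u ∈ K ∧ z = (t : ℂ) • u ∧
      ‖z.1‖ ^ 2 + ‖z.2‖ ^ 2 = t ^ 2 := by
    have hpos : 0 < ‖z.1‖ ^ 2 + ‖z.2‖ ^ 2 := by
      by_contra h
      have h1 : ‖z.1‖ = 0 := by nlinarith [norm_nonneg z.1, norm_nonneg z.2]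
      have h2 : ‖z.2‖ = 0 := by nlinarith [norm_nonneg z.1, norm_nonneg z.2]
      exact hz (Prod.ext (norm_eq_zero.1 h1) (norm_eq_zero.1 h2))
    set t := √(‖z.1‖ ^ 2 + ‖z.2‖ ^ 2) with ht
    have ht0 : 0 < t := Real.sqrt_pos.2 hpos
    have htsq : t ^ 2 = ‖z.1‖ ^ 2 + ‖z.2‖ ^ 2 := Real.sq_sqrt hpos.le
    refine ⟨t, (t : ℂ)⁻¹ • z, ht0, ?_, ?_, htsq.symm⟩
    · simp only [hK, Set.mem_ofPred_eq, Prod.smul_fst, Prod.smul_snd, norm_smul, norm_inv,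
        Complex.norm_real, Real.norm_eq_abs, abs_of_pos ht0, mul_pow, ← mul_add, ← htsq]
      field_simp
    · rw [smul_inv_smul₀ (by exact_mod_cast ht0.ne')]
  have hcont : ContinuousOn (fun z => V z ^ 2 / ‖Q z‖) K :=
    (continuousOn_sq_div_prod hV hS).mono fun z hz => by
      rintro rfl
      simp [hK] at hz
  obtain ⟨z₀, hz₀⟩ := hne
  obtain ⟨t₀, u₀, ht₀, hu₀, hzu₀, -⟩ := hnorm z₀ (by rintro rfl; exact hz₀ (hV.map_zero hd))
  obtain ⟨p, hpK, hpmax⟩ := hKcpt.exists_isMaxOn ⟨u₀, hu₀⟩ hcont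
  have hmax (u) (hu : u ∈ K) : V u ^ 2 / ‖Q u‖ ≤ V p ^ 2 / ‖Q p‖ := hpmax hu
  have hVu₀ : V u₀ ≠ 0 := by
    intro h
    rw [hzu₀, hV.smul, h, mul_zero] at hz₀
    exact hz₀ rfl
  have hpos : 0 < V p ^ 2 / ‖Q p‖ := by
    refine lt_of_lt_of_le ?_ (hmax u₀ hu₀)
    have : Q u₀ ≠ 0 := fun h => hVu₀ (hVQ _ h)
    positivity
  have hQp : Q p ≠ 0 := by
    intro h
    simp [h] at hpos
  have hVp : 0 < V p := by
    refine (hV.nonneg p).lt_of_ne' fun h => ?_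
    simp [h] at hpos
  refine ⟨p, hpK, hVp, Finset.prod_ne_zero_iff.1 hQp, fun z => ?_⟩
  change V z ^ 2 * (‖z.1‖ ^ 2 + ‖z.2‖ ^ 2) * ‖Q p‖ ≤ V p ^ 2 * ‖Q z‖
  rcases eq_or_ne z 0 with rfl | hz
  · simp only [Prod.fst_zero, Prod.snd_zero, norm_zero]
    norm_num
    positivity
  obtain ⟨t, u, ht, hu, hzu, hN⟩ := hnorm z hz
  have h1 : V u ^ 2 * ‖Q p‖ ≤ V p ^ 2 * ‖Q u‖ := by
    rcases eq_or_ne (Q u) 0 with h | h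
    · simp [h, hVQ u h]
    · have := hmax u hu
      rwa [div_le_div_iff₀ (by positivity) (by positivity)] at this
  rw [hN, hzu, hV.smul, hQsmul, norm_mul, norm_pow, Complex.norm_real, Real.norm_eq_abs,
    abs_of_pos ht]
  calc (t ^ d * V u) ^ 2 * t ^ 2 * ‖Q p‖ = t ^ (2 * d + 2) * (V u ^ 2 * ‖Q p‖) := by ring
    _ ≤ t ^ (2 * d + 2) * (V p ^ 2 * ‖Q u‖) := by gcongr
    _ = _ := by ring

end Extremal

/-! ### Failure of the sub-mean inequality at the maximum. -/

theorem IsHomogeneousSubmean.le_circleAverage_radius {E : Type*} [NormedAddCommGroup E]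
    [NormedSpace ℂ E] {d : ℕ} {V : E → ℝ} (hV : IsHomogeneousSubmean d V) (a b : E) (r : ℝ) :
    V a ≤ Real.circleAverage (fun ζ : ℂ => V (a + ζ • b)) 0 r := by
  rw [Real.circleAverage_eq_circleAverage_zero_one]
  refine (hV.le_circleAverage a ((r : ℂ) • b)).trans_eq ?_
  congr 1; ext ζ; rw [smul_smul, add_zero, mul_comm]

/-- The logarithmic derivative at the origin of `∏ (1 + (c + m s) ζ) / (1 + c ζ) ^ 2` vanishes for
a suitable `c`. -/
theorem exists_hasDerivAt_prod_div_sq {d : ℕ} (hd : d ≠ 0) {S : Finset ℂ}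
    (hcard : S.card = 2 * d + 2) (m : ℂ → ℂ) :
    ∃ c : ℂ, HasDerivAt (fun ζ => (∏ s ∈ S, (1 + (c + m s) * ζ)) / (1 + c * ζ) ^ 2) 0 0 := by
  have hd' : (2 * d : ℂ) ≠ 0 := by exact_mod_cast (by omega : 2 * d ≠ 0)
  -- The derivative at 0 is ∑ (c + m s) - 2c = 2dc + ∑ m s, since #S = 2d + 2.
  refine ⟨-(∑ s ∈ S, m s) / (2 * d), ?_⟩
  set c := -(∑ s ∈ S, m s) / (2 * d : ℂ) with hc
  have hlin (k : ℂ) : HasDerivAt (fun ζ : ℂ => 1 + k * ζ) k 0 := by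
    simpa using ((hasDerivAt_id (0 : ℂ)).const_mul k).const_add 1
  have hprod : HasDerivAt (fun ζ => ∏ s ∈ S, (1 + (c + m s) * ζ)) (∑ s ∈ S, (c + m s)) 0 := by
    have := HasDerivAt.fun_finsetProd (u := S) (fun s _ => hlin (c + m s))
    simpa using this
  have := hprod.div ((hlin c).pow 2) (by simp)
  convert! this using 1
  have h2 : c * (2 * d) = -∑ s ∈ S, m s := by rw [hc]; field_simp
  simp [Finset.sum_add_distrib, hcard]
  linear_combination -h2

/-- The product of `2 d + 2` distinct linear forms on `ℂ²` cannot vanish on the zero set of a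
nonzero function of this kind: at a maximum of `V² ‖·‖² / |Q|` the sub-mean value property would
fail along a suitable complex line. -/
theorem IsHomogeneousSubmean.eq_zero {d : ℕ} {V : ℂ × ℂ → ℝ} {S : Finset ℂ}
    (hV : IsHomogeneousSubmean d V) (hd : d ≠ 0) (hcard : S.card = 2 * d + 2)
    (hS : ∀ s ∈ S, ∀ b : ℂ, V (-s * b, b) = 0) (z : ℂ × ℂ) : V z = 0 := by
  by_contra hz
  obtain ⟨p, hp1, hVp, hQp, hmax⟩ := exists_max_sq_div_prod hV hd hcard hS ⟨z, hz⟩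
  -- A unit vector Hermitian-orthogonal to p. The circle will run in direction cp + b, with c free
  -- to cancel the first-order term.
  set b : ℂ × ℂ := (-(starRingEnd ℂ) p.2, (starRingEnd ℂ) p.1) with hb
  set m : ℂ → ℂ := fun s => (b.1 + s * b.2) / (p.1 + s * p.2) with hm
  obtain ⟨c, hc⟩ := exists_hasDerivAt_prod_div_sq hd hcard m
  set G : ℂ → ℂ := fun ζ => (∏ s ∈ S, (1 + (c + m s) * ζ)) / (1 + c * ζ) ^ 2 with hG
  have hN (α β : ℂ) : ‖(α • p + β • b).1‖ ^ 2 + ‖(α • p + β • b).2‖ ^ 2 = ‖α‖ ^ 2 + ‖β‖ ^ 2 := by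
    have h : ((‖(α • p + β • b).1‖ ^ 2 + ‖(α • p + β • b).2‖ ^ 2 : ℝ) : ℂ) =
        ((‖α‖ ^ 2 + ‖β‖ ^ 2 : ℝ) : ℂ) * ((‖p.1‖ ^ 2 + ‖p.2‖ ^ 2 : ℝ) : ℂ) := by
      push_cast
      simp only [← Complex.mul_conj', hb, Prod.fst_add, Prod.snd_add, Prod.smul_fst,
        Prod.smul_snd, smul_eq_mul, map_add, map_mul, map_neg, Complex.conj_conj]
      ring
    rw [hp1, Complex.ofReal_one, mul_one] at h
    exact_mod_cast h
  have hQ (ζ : ℂ) : ∏ s ∈ S, (((1 + c * ζ) • p + ζ • b).1 + s * ((1 + c * ζ) • p + ζ • b).2) =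
      (∏ s ∈ S, (p.1 + s * p.2)) * ∏ s ∈ S, (1 + (c + m s) * ζ) := by
    rw [← Finset.prod_mul_distrib]
    refine Finset.prod_congr rfl fun s hs => ?_
    have h := hQp s hs
    have h2 : (p.1 + s * p.2) * m s = b.1 + s * b.2 := by rw [hm]; field_simp
    simp only [Prod.fst_add, Prod.snd_add, Prod.smul_fst, Prod.smul_snd, smul_eq_mul]
    linear_combination -ζ * h2
  set R : ℝ := (‖c‖ + 1)⁻¹ with hR
  have hR0 : 0 < R := by positivity
  have hcζ (ζ : ℂ) (hζ : ζ ∈ Metric.ball (0 : ℂ) R) : ‖c * ζ‖ < 1 := by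
    rw [mem_ball_zero_iff] at hζ
    calc ‖c * ζ‖ ≤ ‖c‖ * R := by rw [norm_mul]; gcongr
      _ < (‖c‖ + 1) * R := by gcongr; linarith
      _ = 1 := mul_inv_cancel₀ (by positivity)
  have hden (ζ : ℂ) (hζ : ζ ∈ Metric.ball (0 : ℂ) R) : 1 + c * ζ ≠ 0 := by
    intro h
    have h1 : c * ζ = -1 := by linear_combination h
    have h2 := hcζ ζ hζ
    simp [h1] at h2
  have hGdiff : DifferentiableOn ℂ G (Metric.ball 0 R) := by
    apply DifferentiableOn.div (by fun_prop) (by fun_prop)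
    intro ζ hζ
    exact pow_ne_zero 2 (hden ζ hζ)
  -- Any constant below 1/4 would do: the loss r²/8 must stay below the gain r²/4 in `h7`.
  have hev := eventually_circleAverage_norm_le hR0 (by norm_num : (0 : ℝ) < 1 / 8) hGdiff
    (by simp [hG]) hc
  obtain ⟨r, hr1, hr⟩ := (hev.and (Ioo_mem_nhdsGT hR0)).exists
  have hsph (ζ : ℂ) (hζ : ζ ∈ Metric.sphere (0 : ℂ) |r|) : ‖ζ‖ = r ∧ ζ ∈ Metric.ball (0 : ℂ) R := by
    have : ‖ζ‖ = r := by simpa [abs_of_pos hr.1] using hζ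
    exact ⟨this, by simpa [this] using hr.2⟩
  have hline (ζ : ℂ) : p + ζ • (c • p + b) = (1 + c * ζ) • p + ζ • b := by module
  have hbound (ζ : ℂ) (hζ : ζ ∈ Metric.sphere (0 : ℂ) |r|) :
      V (p + ζ • (c • p + b)) ≤ V p * (1 / 2) + V p * (‖G ζ‖ / (2 * (1 + r ^ 2 / 4))) := by
    obtain ⟨hζr, hζR⟩ := hsph ζ hζ
    rw [hline]
    have h1 := hmax ((1 + c * ζ) • p + ζ • b)
    rw [hN, hQ, norm_mul, hζr] at h1
    have h2 : 0 < ‖∏ s ∈ S, (p.1 + s * p.2)‖ := norm_pos_iff.2 (Finset.prod_ne_zero_iff.2 hQp)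
    set v := V ((1 + c * ζ) • p + ζ • b) with hv
    have h3 : ‖∏ s ∈ S, (1 + (c + m s) * ζ)‖ = ‖G ζ‖ * ‖1 + c * ζ‖ ^ 2 := by
      have h := pow_ne_zero 2 (hden ζ hζR)
      rw [← norm_pow, ← norm_mul]; simp only [hG]; rw [div_mul_cancel₀ _ h]
    rw [h3] at h1
    have h4 : v ^ 2 * (‖1 + c * ζ‖ ^ 2 + r ^ 2) ≤ V p ^ 2 * (‖G ζ‖ * ‖1 + c * ζ‖ ^ 2) := by
      refine le_of_mul_le_mul_right ?_ h2
      linarith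
    have h5 : ‖1 + c * ζ‖ ^ 2 ≤ 4 := by
      have := (norm_add_le 1 (c * ζ)).trans (by rw [norm_one]; linarith [hcζ ζ hζR] : _ ≤ (2 : ℝ))
      nlinarith [norm_nonneg (1 + c * ζ)]
    have h6 : 0 < ‖1 + c * ζ‖ ^ 2 := by
      have := norm_pos_iff.2 (hden ζ hζR)
      positivity
    have h7 : v ^ 2 * (1 + r ^ 2 / 4) ≤ V p ^ 2 * ‖G ζ‖ := by
      refine le_of_mul_le_mul_right ?_ h6
      have : v ^ 2 * (r ^ 2 * ‖1 + c * ζ‖ ^ 2) ≤ v ^ 2 * (r ^ 2 * 4) := by gcongr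
      linarith
    have h8 : v ^ 2 ≤ V p ^ 2 * (‖G ζ‖ / (1 + r ^ 2 / 4)) := by
      rw [← mul_div_assoc, le_div_iff₀ (by positivity)]; exact h7
    -- This linearizes the bound on v², so that the mean of ‖G‖ suffices and no square root is
    -- averaged.
    have h9 : 2 * V p * v ≤ V p ^ 2 + v ^ 2 := by nlinarith [sq_nonneg (V p - v)]
    have h10 : V p * v ≤ V p * (V p * (1 / 2) + V p * (‖G ζ‖ / (2 * (1 + r ^ 2 / 4)))) := by
      have : ‖G ζ‖ / (2 * (1 + r ^ 2 / 4)) = ‖G ζ‖ / (1 + r ^ 2 / 4) / 2 := by field_simp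
      rw [this]
      linarith
    exact le_of_mul_le_mul_left h10 hVp
  have hVint : CircleIntegrable (fun ζ : ℂ => V (p + ζ • (c • p + b))) 0 r := by
    apply ContinuousOn.circleIntegrable'
    have := hV.continuous
    fun_prop
  have hGint : CircleIntegrable (fun ζ : ℂ => ‖G ζ‖) 0 r :=
    ((hGdiff.continuousOn.mono fun ζ hζ => (hsph ζ hζ).2).norm).circleIntegrable'
  have hfin := (hV.le_circleAverage_radius p (c • p + b) r).trans
    (Real.circleAverage_mono (f₂ := fun ζ => V p * (1 / 2) +
      (V p / (2 * (1 + r ^ 2 / 4))) • ‖G ζ‖) hVint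
      ((circleIntegrable_const _ _ _).add (hGint.const_smul)) fun ζ hζ =>
        (hbound ζ hζ).trans_eq (by simp only [smul_eq_mul]; ring))
  rw [Real.circleAverage_fun_add (f₂ := fun ζ => (V p / (2 * (1 + r ^ 2 / 4))) • ‖G ζ‖)
    (circleIntegrable_const _ _ _) hGint.const_smul,
    Real.circleAverage_const, Real.circleAverage_fun_smul, smul_eq_mul] at hfin
  have h1 : V p / (2 * (1 + r ^ 2 / 4)) * Real.circleAverage (fun ζ => ‖G ζ‖) 0 r ≤
      V p / (2 * (1 + r ^ 2 / 4)) * (1 + 1 / 8 * r ^ 2) := by gcongr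
  have h2 : V p / (2 * (1 + r ^ 2 / 4)) * (1 + 1 / 8 * r ^ 2) < V p * (1 / 2) := by
    rw [div_mul_eq_mul_div, div_lt_iff₀ (by positivity)]
    nlinarith [mul_pos hVp (pow_pos hr.1 2)]
  linarith

/-! ### Averages over rotations. -/

theorem Real.circleAverage_comm {F : ℂ → ℂ → ℝ} (hF : Continuous (Function.uncurry F)) :
    Real.circleAverage (fun z => Real.circleAverage (F z) 0 1) 0 1 =
      Real.circleAverage (fun w => Real.circleAverage (fun z => F z w) 0 1) 0 1 := by
  simp only [Real.circleAverage_def, intervalIntegral.integral_smul]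
  congr 2
  apply MeasureTheory.intervalIntegral_intervalIntegral_swap
  have hc : Continuous (Function.uncurry fun x y : ℝ => F (circleMap 0 1 x) (circleMap 0 1 y)) :=
    hF.comp (((continuous_circleMap 0 1).comp continuous_fst).prodMk
      ((continuous_circleMap 0 1).comp continuous_snd))
  exact (hc.continuousOn.integrableOn_compact (isCompact_uIcc.prod isCompact_uIcc)).mono_set
    (Set.prod_mono Set.uIoc_subset_uIcc Set.uIoc_subset_uIcc)

theorem Real.circleAverage_comp_mul_left {f : ℂ → ℝ} {c : ℂ} (hc : ‖c‖ = 1) :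
    Real.circleAverage (fun ζ => f (ζ * c)) 0 1 = Real.circleAverage f 0 1 := by
  rw [Real.circleAverage_eq_integral_add (f := f) c.arg, Real.circleAverage_def]
  congr 2; ext θ; congr 1
  have h : c = Complex.exp (c.arg * Complex.I) := by
    simpa [hc] using (Complex.norm_mul_exp_arg_mul_I c).symm
  conv_lhs => rw [h]
  simp [circleMap, ← Complex.exp_add, add_mul]

section RotationAverage

variable {E : Type*} [NormedAddCommGroup E] [NormedSpace ℂ E] {P : E → ℝ}

/-- The average of `P` over the rotations of a vector by complex numbers of modulus one. -/
noncomputable def rotationAverage (P : E → ℝ) (z : E) : ℝ :=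
  Real.circleAverage (fun ζ : ℂ => P (ζ • z)) 0 1

theorem circleIntegrable_smul (hP : Continuous P) (z : E) (r : ℝ) :
    CircleIntegrable (fun ζ : ℂ => P (ζ • z)) 0 r :=
  ContinuousOn.circleIntegrable' (by fun_prop)

theorem rotationAverage_smul_of_norm_eq_one (P : E → ℝ) {c : ℂ} (hc : ‖c‖ = 1) (z : E) :
    rotationAverage P (c • z) = rotationAverage P z := by
  simp only [rotationAverage, smul_smul]
  exact Real.circleAverage_comp_mul_left (f := fun ζ => P (ζ • z)) hc

theorem rotationAverage_smul {d : ℕ} (hP : ∀ (r : ℝ) z, P ((r : ℂ) • z) = r ^ d * P z)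
    (c : ℂ) (z : E) : rotationAverage P (c • z) = ‖c‖ ^ d * rotationAverage P z := by
  have hr (r : ℝ) (z : E) : rotationAverage P ((r : ℂ) • z) = r ^ d * rotationAverage P z := by
    simp only [rotationAverage, smul_comm _ (r : ℂ), hP]
    exact Real.circleAverage_fun_smul (a := r ^ d)
  have h : c • z = ((‖c‖ : ℝ) : ℂ) • Complex.exp (c.arg * Complex.I) • z := by
    rw [smul_smul, Complex.norm_mul_exp_arg_mul_I]
  rw [h, hr, rotationAverage_smul_of_norm_eq_one P (Complex.norm_exp_ofReal_mul_I _)]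

/-- The average over rotations of the mean of `P` over the circle with centre `a` and direction `b`
is the mean of the rotation average. -/
theorem circleAverage_circleAverage_smul (hP : Continuous P) (a b : E) :
    Real.circleAverage (fun η : ℂ => Real.circleAverage (fun ζ : ℂ => P (η • a + ζ • η • b)) 0 1) 0 1
      = Real.circleAverage (fun ζ : ℂ => rotationAverage P (a + ζ • b)) 0 1 := by
  rw [Real.circleAverage_comm (F := fun η ζ => P (η • a + ζ • η • b))
    (by unfold Function.uncurry; fun_prop)]
  unfold rotationAverage
  congr 1; ext ζ; congr 1; ext η; congr 1
  module

theorem continuous_circleAverage_line (hP : Continuous P) (a b : E) :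
    Continuous fun η : ℂ => Real.circleAverage (fun ζ : ℂ => P (η • a + ζ • η • b)) 0 1 := by
  simp only [Real.circleAverage_def]
  refine Continuous.fun_const_smul ?_ _
  apply intervalIntegral.continuous_parametric_intervalIntegral_of_continuous'
  have := continuous_circleMap 0 1
  unfold Function.uncurry
  fun_prop

/-- Apply the inequality to each rotated circle ηa + ζηb, average over η and swap the two means. -/
theorem rotationAverage_le_circleAverage (hP : Continuous P)
    (hsub : ∀ a b : E, P a ≤ Real.circleAverage (fun ζ : ℂ => P (a + ζ • b)) 0 1) (a b : E) :
    rotationAverage P a ≤ Real.circleAverage (fun ζ : ℂ => rotationAverage P (a + ζ • b)) 0 1 := by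
  rw [← circleAverage_circleAverage_smul hP]
  exact Real.circleAverage_mono (circleIntegrable_smul hP a 1)
    (continuous_circleAverage_line hP a b).continuousOn.circleIntegrable' fun η _ => hsub _ _

theorem isHomogeneousSubmean_rotationAverage {d : ℕ} (hd : d ≠ 0) (hP : Continuous P)
    (hhom : ∀ (r : ℝ) z, P ((r : ℂ) • z) = r ^ d * P z)
    (hsub : ∀ a b : E, P a ≤ Real.circleAverage (fun ζ : ℂ => P (a + ζ • b)) 0 1)
    (hlip : ∀ R : ℝ, ∃ L : ℝ, 0 ≤ L ∧ ∀ z w : E, ‖z‖ ≤ R → ‖w‖ ≤ R → |P z - P w| ≤ L * ‖z - w‖) :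
    IsHomogeneousSubmean d (rotationAverage P) where
  nonneg z := by
    have h0 : P 0 = 0 := by simpa [hd] using hhom 0 0
    simpa [h0, rotationAverage] using hsub 0 z
  smul := rotationAverage_smul hhom
  le_circleAverage := rotationAverage_le_circleAverage hP hsub
  lipschitz R := by
    obtain ⟨L, hL0, hL⟩ := hlip R
    refine ⟨L, hL0, fun z w hz hw => ?_⟩
    have hz' := circleIntegrable_smul hP z 1
    have hw' := circleIntegrable_smul hP w 1
    rw [rotationAverage, rotationAverage, ← Real.circleAverage_fun_sub hz' hw']
    refine Real.abs_circleAverage_le_circleAverage_abs.trans ?_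
    refine Real.circleAverage_mono_on_of_le_circle (hz'.sub hw').abs fun ζ hζ => ?_
    have hζ1 : ‖ζ‖ = 1 := by simpa using hζ
    have := hL (ζ • z) (ζ • w) (by simpa [norm_smul, hζ1]) (by simpa [norm_smul, hζ1])
    rwa [← smul_sub, norm_smul, hζ1, one_mul] at this

/-- If the rotation average vanishes identically, then the sub-mean value inequality is an equality
on circles contained in a line through the origin. -/
theorem circleAverage_eq_of_rotationAverage_eq_zero (hP : Continuous P)
    (hsub : ∀ a b : E, P a ≤ Real.circleAverage (fun ζ : ℂ => P (a + ζ • b)) 0 1)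
    (h0 : ∀ z, rotationAverage P z = 0) (w : E) :
    Real.circleAverage (fun ζ : ℂ => P (w + ζ • w)) 0 1 = P w := by
  set D : ℂ → ℝ := fun η => Real.circleAverage (fun ζ : ℂ => P (η • w + ζ • η • w)) 0 1 - P (η • w)
    with hD
  have hDc : Continuous D := by
    have := continuous_circleAverage_line hP w w
    fun_prop
  have hD0 (η) : 0 ≤ D η := sub_nonneg.2 (hsub _ _)
  -- Both terms of D average to values or means of `rotationAverage P`, hence to 0; a continuous
  -- nonnegative D with mean 0 vanishes on the unit circle, in particular at 1.
  have havg : Real.circleAverage D 0 1 = 0 := by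
    rw [hD, Real.circleAverage_fun_sub
      (continuous_circleAverage_line hP w w).continuousOn.circleIntegrable'
      (circleIntegrable_smul hP w 1), circleAverage_circleAverage_smul hP]
    have := h0 w
    unfold rotationAverage at this
    simp only [h0, this, Real.circleAverage_const, sub_zero]
  have hint : ∫ θ in (0 : ℝ)..2 * Real.pi, D (circleMap 0 1 θ) = 0 := by
    rw [Real.circleAverage_def, smul_eq_mul] at havg
    exact (mul_eq_zero.1 havg).resolve_left (by positivity)
  have hDθ : Continuous fun θ => D (circleMap 0 1 θ) := hDc.comp (continuous_circleMap 0 1)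
  by_contra hne
  have hpos : 0 < D 1 := by
    refine (hD0 1).lt_of_ne' fun h => hne ?_
    simpa [hD, sub_eq_zero] using h
  have := intervalIntegral.integral_pos (f := fun θ => D (circleMap 0 1 θ)) Real.two_pi_pos
    hDθ.continuousOn (fun θ _ => hD0 _)
    ⟨0, Set.left_mem_Icc.2 Real.two_pi_pos.le, by simpa [circleMap] using hpos⟩
  linarith

end RotationAverage

/-! ### Trigonometric polynomials on the unit circle. -/

theorem Complex.circleAverage_zpow (n : ℤ) :
    Real.circleAverage (fun ζ : ℂ => ζ ^ n) 0 1 = if n = 0 then 1 else 0 := by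
  split_ifs with h
  · simp [h, Real.circleAverage_const]
  rw [Real.circleAverage_eq_circleIntegral one_ne_zero]
  have : (∮ z in C(0, 1), (z - 0)⁻¹ • z ^ n) = ∮ z in C(0, 1), (z - 0) ^ (n - 1) := by
    refine circleIntegral.integral_congr zero_le_one fun z hz => ?_
    have hz0 : z ≠ 0 := ne_zero_of_mem_unit_sphere ⟨z, hz⟩
    simp only [sub_zero, smul_eq_mul]
    rw [zpow_sub_one₀ hz0, mul_comm]
  rw [this, circleIntegral.integral_sub_zpow_of_ne (by omega), smul_zero]

/-- On the unit circle the conjugate of 1 + ζ is (1 + ζ)ζ⁻¹, so the integrand is (1 + ζ)^(a+b)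
ζ^(-b) and its mean is the constant coefficient. -/
theorem Complex.circleAverage_one_add_pow_mul_conj (a b : ℕ) :
    Real.circleAverage (fun ζ : ℂ => (1 + ζ) ^ a * (starRingEnd ℂ) (1 + ζ) ^ b) 0 1 =
      ((a + b).choose b : ℂ) := by
  have h1 : Real.circleAverage (fun ζ : ℂ => (1 + ζ) ^ a * (starRingEnd ℂ) (1 + ζ) ^ b) 0 1 =
      Real.circleAverage (fun ζ : ℂ => ∑ k ∈ Finset.range (a + b + 1),
        ((a + b).choose k : ℂ) • ζ ^ ((k : ℤ) - b)) 0 1 := by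
    apply Real.circleAverage_congr_sphere
    intro ζ hζ
    have hζ1 : ‖ζ‖ = 1 := by simpa using hζ
    have hζ0 : ζ ≠ 0 := norm_ne_zero_iff.1 (by simp [hζ1])
    have hconj : (starRingEnd ℂ) (1 + ζ) = (1 + ζ) * ζ⁻¹ := by
      rw [map_add, map_one, add_mul, one_mul, mul_inv_cancel₀ hζ0, Complex.inv_eq_conj hζ1, add_comm]
    simp only
    rw [hconj, mul_pow, ← mul_assoc, ← pow_add, add_comm 1 ζ, add_pow, Finset.sum_mul]
    refine Finset.sum_congr rfl fun k _ => ?_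
    rw [zpow_sub₀ hζ0, zpow_natCast, zpow_natCast, one_pow, smul_eq_mul, inv_pow]
    ring
  have hint (k : ℕ) : CircleIntegrable (fun ζ : ℂ => ((a + b).choose k : ℂ) • ζ ^ ((k : ℤ) - b)) 0 1 := by
    apply ContinuousOn.circleIntegrable'
    refine ContinuousOn.fun_const_smul (fun z hz => ?_) _
    exact (continuousAt_zpow₀ _ _ (Or.inl (norm_ne_zero_iff.1 (by
      have : ‖z‖ = 1 := by simpa using hz
      simp [this])))).continuousWithinAt
  rw [h1, Real.circleAverage_fun_sum fun k _ => hint k]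
  simp only [Real.circleAverage_fun_smul, Complex.circleAverage_zpow, sub_eq_zero, Nat.cast_inj]
  simp

theorem Complex.infinite_sphere : (Metric.sphere (0 : ℂ) 1).Infinite := by
  apply (isPreconnected_sphere (by simp) 0 1).infinite_of_nontrivial
  exact ⟨1, by simp, -1, by simp, by norm_num⟩

/-- A trigonometric polynomial that vanishes on the unit circle has no terms. -/
theorem Complex.coeff_eq_zero_of_forall_sum_mul_conj {d : ℕ} {c : ℕ → ℂ}
    (h : ∀ u : ℂ, ‖u‖ = 1 →
      ∑ a ∈ Finset.range (d + 1), u ^ a * (starRingEnd ℂ) u ^ (d - a) * c a = 0)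
    {a : ℕ} (ha : a ≤ d) : c a = 0 := by
  -- Multiplication by u^d turns the term of index a into c a * u^(2a) when |u| = 1.
  set q : Polynomial ℂ := ∑ a ∈ Finset.range (d + 1), Polynomial.monomial (2 * a) (c a) with hq
  have hq0 : q = 0 := by
    apply Polynomial.eq_zero_of_infinite_isRoot
    refine Complex.infinite_sphere.mono fun u hu => ?_
    have hu1 : ‖u‖ = 1 := by simpa using hu
    have huu : u * (starRingEnd ℂ) u = 1 := by rw [Complex.mul_conj']; simp [hu1]
    change Polynomial.eval u q = 0
    rw [hq, Polynomial.eval_finsetSum, ← mul_zero (u ^ d), ← h u hu1, Finset.mul_sum]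
    refine Finset.sum_congr rfl fun a ha => ?_
    obtain ⟨b, rfl⟩ := Nat.exists_eq_add_of_le (Nat.lt_succ_iff.1 (Finset.mem_range.1 ha))
    rw [Polynomial.eval_monomial, Nat.add_sub_cancel_left]
    calc c a * u ^ (2 * a) = u ^ a * u ^ a * (u * (starRingEnd ℂ) u) ^ b * c a := by
          rw [huu]; ring
      _ = _ := by ring
  have := congrArg (fun r => Polynomial.coeff r (2 * a)) hq0
  simpa [hq, Polynomial.finsetSum_coeff, Polynomial.coeff_monomial, Nat.lt_succ_iff, ha] using this

/-! ### Decomposition by bidegree. -/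

section BidegreePart

variable {n : ℕ}

/-- A vector together with its conjugate. -/
noncomputable def withConj (z : Fin n → ℂ) : Fin n ⊕ Fin n → ℂ :=
  Sum.elim z fun j => (starRingEnd ℂ) (z j)

/-- The value at `z` of the terms of `p` that have degree `a` in the variables `Sum.inl j`, the
variables `Sum.inr j` being replaced by conjugates. -/
noncomputable def bidegreePart (p : MvPolynomial (Fin n ⊕ Fin n) ℂ) (a : ℕ) (z : Fin n → ℂ) : ℂ :=
  ∑ m ∈ p.support with ∑ j, m (Sum.inl j) = a, p.coeff m * ∏ i, withConj z i ^ m i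

theorem sum_inr_eq {p : MvPolynomial (Fin n ⊕ Fin n) ℂ} {d : ℕ} (hp : p.IsHomogeneous d)
    {m : (Fin n ⊕ Fin n) →₀ ℕ} (hm : m ∈ p.support) :
    ∑ j, m (Sum.inl j) + ∑ j, m (Sum.inr j) = d := by
  have := hp.degree_eq_sum_deg_support hm
  rw [this, ← Fintype.sum_sum_type (fun i => m i)]
  exact (Finset.sum_subset (Finset.subset_univ _) (by simp)).symm

theorem prod_withConj_smul (m : (Fin n ⊕ Fin n) →₀ ℕ) (u : ℂ) (z : Fin n → ℂ) :
    ∏ i, withConj (u • z) i ^ m i = u ^ (∑ j, m (Sum.inl j)) *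
      (starRingEnd ℂ) u ^ (∑ j, m (Sum.inr j)) * ∏ i, withConj z i ^ m i := by
  simp only [Fintype.prod_sum_type, withConj, Sum.elim_inl, Sum.elim_inr, Pi.smul_apply,
    smul_eq_mul, map_mul, mul_pow, Finset.prod_mul_distrib, Finset.prod_pow_eq_pow_sum]
  ring

theorem bidegreePart_smul {p : MvPolynomial (Fin n ⊕ Fin n) ℂ} {d : ℕ} (hp : p.IsHomogeneous d)
    (u : ℂ) {a : ℕ} (z : Fin n → ℂ) : bidegreePart p a (u • z) =
      u ^ a * (starRingEnd ℂ) u ^ (d - a) * bidegreePart p a z := by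
  rw [bidegreePart, bidegreePart, Finset.mul_sum]
  refine Finset.sum_congr rfl fun m hm => ?_
  obtain ⟨hm', rfl⟩ := Finset.mem_filter.1 hm
  rw [prod_withConj_smul, ← sum_inr_eq hp hm', Nat.add_sub_cancel_left]
  ring

theorem eval_smul_eq_sum {p : MvPolynomial (Fin n ⊕ Fin n) ℂ} {d : ℕ} (hp : p.IsHomogeneous d)
    (u : ℂ) (z : Fin n → ℂ) : MvPolynomial.eval (withConj (u • z)) p =
      ∑ a ∈ Finset.range (d + 1), u ^ a * (starRingEnd ℂ) u ^ (d - a) * bidegreePart p a z := by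
  rw [MvPolynomial.eval_eq', ← Finset.sum_fiberwise_of_maps_to
    (t := Finset.range (d + 1)) (g := fun m => ∑ j, m (Sum.inl j))]
  · refine Finset.sum_congr rfl fun a _ => ?_
    rw [← bidegreePart_smul hp]
    rfl
  · intro m hm
    have := sum_inr_eq hp hm
    rw [Finset.mem_range]
    omega

theorem contDiff_eval_withConj (p : MvPolynomial (Fin n ⊕ Fin n) ℂ) {k : WithTop ℕ∞} :
    ContDiff ℝ k fun z : Fin n → ℂ => MvPolynomial.eval (withConj z) p := by
  have hi (i : Fin n ⊕ Fin n) : ContDiff ℝ k fun z : Fin n → ℂ => withConj z i := by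
    rcases i with j | j
    · exact contDiff_apply ℝ ℂ j
    · exact Complex.conjCLE.contDiff.comp (contDiff_apply ℝ ℂ j)
  simp only [MvPolynomial.eval_eq']
  exact ContDiff.sum fun m _ => contDiff_const.mul (contDiff_prod fun i _ => (hi i).pow _)

theorem differentiable_bidegreePart_top {p : MvPolynomial (Fin n ⊕ Fin n) ℂ} {d : ℕ}
    (hp : p.IsHomogeneous d) : Differentiable ℂ (bidegreePart p d) := by
  unfold bidegreePart
  refine Differentiable.fun_sum fun m hm => ?_
  obtain ⟨hm, hmd⟩ := Finset.mem_filter.1 hm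
  have h0 : ∑ j, m (Sum.inr j) = 0 := by have := sum_inr_eq hp hm; omega
  have h0' (j) : m (Sum.inr j) = 0 := Finset.sum_eq_zero_iff.1 h0 j (Finset.mem_univ j)
  simp only [Fintype.prod_sum_type, withConj, Sum.elim_inl, Sum.elim_inr, h0', pow_zero,
    Finset.prod_const_one, mul_one]
  fun_prop

theorem differentiable_conj_bidegreePart_zero (p : MvPolynomial (Fin n ⊕ Fin n) ℂ) :
    Differentiable ℂ fun z => (starRingEnd ℂ) (bidegreePart p 0 z) := by
  unfold bidegreePart
  simp only [map_sum, map_mul, map_prod, map_pow]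
  refine Differentiable.fun_sum fun m hm => ?_
  obtain ⟨hm, hm0⟩ := Finset.mem_filter.1 hm
  have h0' (j) : m (Sum.inl j) = 0 := Finset.sum_eq_zero_iff.1 hm0 j (Finset.mem_univ j)
  simp only [Fintype.prod_sum_type, withConj, Sum.elim_inl, Sum.elim_inr, h0', pow_zero,
    Finset.prod_const_one, one_mul, Complex.conj_conj]
  fun_prop

end BidegreePart

/-! ### Real homogeneous polynomials and pluriharmonicity. -/

section Polynomial

variable {n d : ℕ} {P : (Fin n → ℂ) → ℝ}

theorem IsHomogeneousPolynomialFun.contDiff (hP : IsHomogeneousPolynomialFun d P)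
    {k : WithTop ℕ∞} : ContDiff ℝ k P := by
  obtain ⟨p, -, hpP⟩ := hP
  have h : P = fun z => (MvPolynomial.eval (withConj z) p).re := by
    ext z
    rw [← Complex.ofReal_re (P z), hpP]
    rfl
  rw [h]
  exact Complex.reCLM.contDiff.comp (contDiff_eval_withConj p)

theorem IsHomogeneousPolynomialFun.map_real_smul (hP : IsHomogeneousPolynomialFun d P)
    (r : ℝ) (z : Fin n → ℂ) : P ((r : ℂ) • z) = r ^ d * P z := by
  obtain ⟨p, hp, hpP⟩ := hP
  apply Complex.ofReal_injective
  have h1 := eval_smul_eq_sum hp r z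
  have h2 := eval_smul_eq_sum hp 1 z
  push_cast
  rw [hpP, hpP]
  change MvPolynomial.eval (withConj _) p = _ * MvPolynomial.eval (withConj z) p
  rw [one_smul] at h2
  rw [h1, h2, Finset.mul_sum]
  refine Finset.sum_congr rfl fun a ha => ?_
  obtain ⟨b, rfl⟩ := Nat.exists_eq_add_of_le (Nat.lt_succ_iff.1 (Finset.mem_range.1 ha))
  simp [← pow_add]

theorem IsHomogeneousPolynomialFun.exists_lipschitz (hP : IsHomogeneousPolynomialFun d P)
    (R : ℝ) : ∃ L : ℝ, 0 ≤ L ∧ ∀ z w : Fin n → ℂ, ‖z‖ ≤ R → ‖w‖ ≤ R →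
      |P z - P w| ≤ L * ‖z - w‖ := by
  have hc : ContDiff ℝ 1 P := hP.contDiff
  obtain ⟨C, hC⟩ := ((isCompact_closedBall (0 : Fin n → ℂ) R).exists_bound_of_continuousOn
    (hc.continuous_fderiv one_ne_zero).continuousOn)
  refine ⟨max C 0, le_max_right _ _, fun z w hz hw => ?_⟩
  have := (convex_closedBall (0 : Fin n → ℂ) R).norm_image_sub_le_of_norm_fderiv_le (𝕜 := ℝ)
    (f := P) (C := max C 0) (fun x _ => hc.differentiable one_ne_zero x)
    (fun x hx => (hC x hx).trans (le_max_left _ _)) (mem_closedBall_zero_iff.2 hw)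
    (mem_closedBall_zero_iff.2 hz)
  simpa using this

theorem IsHomogeneousPolynomialFun.isPluriharmonic_of_eq_re (hP : IsHomogeneousPolynomialFun d P)
    {h : (Fin n → ℂ) → ℂ} (hh : Differentiable ℂ h) (hPh : ∀ z, P z = (h z).re) :
    IsPluriharmonic P where
  contDiff := hP.contDiff
  harmonic_line a b ζ _ := by
    have hd : Differentiable ℂ fun ζ : ℂ => h (a + ζ • b) := by fun_prop
    simp only [hPh]
    exact (hd.analyticAt ζ).harmonicAt_re

/-- A homogeneous polynomial function that satisfies the mean value equality on circles contained
in lines through the origin is the real part of a holomorphic polynomial. -/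
theorem IsHomogeneousPolynomialFun.isPluriharmonic_of_circleAverage_eq
    (hP : IsHomogeneousPolynomialFun d P)
    (hmean : ∀ w, Real.circleAverage (fun ζ : ℂ => P (w + ζ • w)) 0 1 = P w) :
    IsPluriharmonic P := by
  have hPc : Continuous P := (hP.contDiff (k := 0)).continuous
  obtain ⟨p, hp, hpP⟩ := id hP
  have hpart (u : ℂ) (z) : (P (u • z) : ℂ) =
      ∑ a ∈ Finset.range (d + 1), u ^ a * (starRingEnd ℂ) u ^ (d - a) * bidegreePart p a z := by
    rw [hpP]
    exact eval_smul_eq_sum hp u z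
  have hP1 (z) : (P z : ℂ) = ∑ a ∈ Finset.range (d + 1), bidegreePart p a z := by
    simpa using hpart 1 z
  have havg (w : Fin n → ℂ) : (P w : ℂ) =
      ∑ a ∈ Finset.range (d + 1), (d.choose a : ℂ) * bidegreePart p a w := by
    have hint : CircleIntegrable (fun ζ : ℂ => P (w + ζ • w)) 0 1 :=
      ContinuousOn.circleIntegrable' (by fun_prop)
    have h1 := Complex.ofRealCLM.circleAverage_comp_comm hint
    rw [hmean] at h1
    have h2 : (Complex.ofRealCLM ∘ fun ζ : ℂ => P (w + ζ • w)) = fun ζ : ℂ =>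
        ∑ a ∈ Finset.range (d + 1), bidegreePart p a w •
          ((1 + ζ) ^ a * (starRingEnd ℂ) (1 + ζ) ^ (d - a)) := by
      ext ζ
      have : w + ζ • w = (1 + ζ) • w := by module
      rw [Function.comp_apply, this]
      refine (hpart (1 + ζ) w).trans (Finset.sum_congr rfl fun a _ => ?_)
      rw [smul_eq_mul, mul_comm]
    have hcont (a : ℕ) : Continuous fun ζ : ℂ => bidegreePart p a w •
        ((1 + ζ) ^ a * (starRingEnd ℂ) (1 + ζ) ^ (d - a)) := by
      have := Complex.continuous_conj
      fun_prop
    rw [h2, Real.circleAverage_fun_sum fun a _ => (hcont a).continuousOn.circleIntegrable'] at h1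
    refine (h1.symm).trans (Finset.sum_congr rfl fun a ha => ?_)
    have had : a ≤ d := Nat.lt_succ_iff.1 (Finset.mem_range.1 ha)
    rw [Real.circleAverage_fun_smul, Complex.circleAverage_one_add_pow_mul_conj, smul_eq_mul,
      Nat.add_sub_cancel' had, Nat.choose_symm had, mul_comm]
  -- Comparing `havg` with `hP1` at every rotation u • w gives a vanishing trigonometric polynomial
  -- in u, which separates the bidegrees.
  have hzero (w) (a : ℕ) (ha : a ≤ d) : ((d.choose a : ℂ) - 1) * bidegreePart p a w = 0 := by
    refine Complex.coeff_eq_zero_of_forall_sum_mul_conj (d := d)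
      (c := fun a => ((d.choose a : ℂ) - 1) * bidegreePart p a w) (fun u _ => ?_) ha
    rw [← sub_eq_zero.2 ((havg (u • w)).symm.trans (hP1 (u • w))), ← Finset.sum_sub_distrib]
    refine Finset.sum_congr rfl fun a _ => ?_
    rw [bidegreePart_smul hp u]
    ring
  have hmid (w) (a : ℕ) (ha0 : a ≠ 0) (ha : a < d) : bidegreePart p a w = 0 := by
    refine (mul_eq_zero.1 (hzero w a ha.le)).resolve_left fun h => ?_
    have h1 : d.choose a = 1 := by exact_mod_cast sub_eq_zero.1 h
    rcases Nat.choose_eq_one_iff.1 h1 with h2 | h2 <;> omega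
  -- For d = 0 the holomorphic and antiholomorphic parts coincide and must not be counted twice.
  rcases Nat.eq_zero_or_pos d with rfl | hd
  · refine hP.isPluriharmonic_of_eq_re (differentiable_bidegreePart_top hp) fun z => ?_
    rw [← Complex.ofReal_re (P z), hP1]
    simp
  refine hP.isPluriharmonic_of_eq_re
    ((differentiable_bidegreePart_top hp).add (differentiable_conj_bidegreePart_zero p)) fun z => ?_
  obtain ⟨e, rfl⟩ := Nat.exists_eq_succ_of_ne_zero hd.ne'
  rw [← Complex.ofReal_re (P z), hP1, Finset.sum_range_succ, Finset.sum_range_succ',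
    Finset.sum_eq_zero fun a ha => hmid z (a + 1) (by omega) (by have := Finset.mem_range.1 ha; omega)]
  simp [add_comm]

end Polynomial

/-! ### From hyperplanes to lines in a plane. -/

section Hyperplanes

theorem rotationAverage_eq_of_isPluriharmonicAlong {E : Type*} [NormedAddCommGroup E]
    [NormedSpace ℂ E] {P : E → ℝ} {H : Submodule ℂ E} (hH : IsPluriharmonicAlong P H) {z : E}
    (hz : z ∈ H) : rotationAverage P z = P 0 := by
  have h := (hH.harmonic_line 0 ⟨z, hz⟩).mono (Set.subset_univ (Metric.closedBall (0 : ℂ) |1|))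
  simpa [rotationAverage] using h.circleAverage_eq

/-- A hyperplane not containing `w` is the kernel of a linear functional with value `1` at `w`. -/
theorem exists_ker_eq_of_finrank_add_one {E : Type*} [AddCommGroup E] [Module ℂ E]
    [FiniteDimensional ℂ E] {H : Submodule ℂ E}
    (hH : Module.finrank ℂ H + 1 = Module.finrank ℂ E) {w : E} (hw : w ∉ H) :
    ∃ l : Module.Dual ℂ E, LinearMap.ker l = H ∧ l w = 1 := by
  obtain ⟨f, hf, hHf⟩ := Submodule.exists_le_ker_of_notMem hw
  have hle : H ≤ LinearMap.ker ((f w)⁻¹ • f) := fun x hx => by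
    simp [LinearMap.mem_ker.1 (hHf hx)]
  have h1 : ((f w)⁻¹ • f) w = 1 := by simp [hf]
  refine ⟨(f w)⁻¹ • f, (Submodule.eq_of_le_of_finrank_le hle ?_).symm, h1⟩
  have hne : LinearMap.ker ((f w)⁻¹ • f) ≠ ⊤ := by
    intro h
    have : w ∈ LinearMap.ker ((f w)⁻¹ • f) := h ▸ Submodule.mem_top
    rw [LinearMap.mem_ker, h1] at this
    exact one_ne_zero this
  have := Submodule.finrank_lt hne
  omega

/-- Among finitely many distinct functionals, some vector separates any two. -/
theorem exists_injective_apply {E : Type*} [AddCommGroup E] [Module ℂ E]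
    {ι : Type*} [Finite ι] {l : ι → Module.Dual ℂ E} (hl : Function.Injective l) :
    ∃ v : E, Function.Injective fun i => l i v := by
  obtain ⟨v, hv⟩ := Module.Dual.exists_forall_ne_zero_of_forall_exists
    (fun q : {q : ι × ι // q.1 ≠ q.2} => l q.1.1 - l q.1.2) (fun q => by
      by_contra! h
      exact q.2 (hl (sub_eq_zero.1 (LinearMap.ext h))))
  refine ⟨v, fun i j hij => ?_⟩
  by_contra hne
  exact hv ⟨(i, j), hne⟩ (sub_eq_zero.2 hij)

/-- A function of this kind that is not identically zero vanishes on finitely many hyperplanes. -/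
theorem IsHomogeneousSubmean.finite_hyperplanes {E : Type*} [NormedAddCommGroup E]
    [NormedSpace ℂ E] [FiniteDimensional ℂ E] {d : ℕ} {U : E → ℝ}
    (hU : IsHomogeneousSubmean d U)
    (hd : d ≠ 0) {w : E} (hw : U w ≠ 0) :
    {H : Submodule ℂ E | Module.finrank ℂ H + 1 = Module.finrank ℂ E ∧ ∀ z ∈ H, U z = 0}.Finite := by
  by_contra hinf
  obtain ⟨T, hT, hcard⟩ := Set.Infinite.exists_subset_card_eq hinf (2 * d + 2)
  have hex (H : T) : ∃ l : Module.Dual ℂ E, LinearMap.ker l = H ∧ l w = 1 :=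
    exists_ker_eq_of_finrank_add_one (hT H.2).1 fun h => hw ((hT H.2).2 w h)
  choose l hker hlw using hex
  have hinj : Function.Injective l := fun H H' h => Subtype.ext (by rw [← hker, ← hker, h])
  obtain ⟨v, hv⟩ := exists_injective_apply hinj
  -- Since l H (αw + βv) = α + β · l H v, each hyperplane cuts the plane in the line with s = l H v;
  -- the point (1, 0) is w itself.
  have hzero := (hU.comp_prod w v).eq_zero (S := Finset.univ.image fun H => l H v) hd
    (by rw [Finset.card_image_of_injective _ hv, Finset.card_univ, Fintype.card_coe, hcard])
    (fun s hs b => by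
      obtain ⟨H, -, rfl⟩ := Finset.mem_image.1 hs
      apply (hT H.2).2
      rw [← hker, LinearMap.mem_ker]
      simp [hlw, mul_comm]) (1, 0)
  exact hw (by simpa using hzero)

end Hyperplanes

theorem mainTheorem1 (n : ℕ) (hn : 2 ≤ n) (P : (Fin n → ℂ) → ℝ)
    (hhom : ∃ d : ℕ, IsHomogeneousPolynomialFun d P)
    (hpsh : IsPlurisubharmonic P)
    (hnph : ¬ IsPluriharmonic P) :
    {H : Submodule ℂ (Fin n → ℂ) |
      Module.finrank ℂ H + 1 = n ∧ IsPluriharmonicAlong P H}.Finite := by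
  obtain ⟨d, hP⟩ := hhom
  have hPc : Continuous P := (hP.contDiff (k := 0)).continuous
  -- In degree 0, P is constant, hence pluriharmonic.
  have hd : d ≠ 0 := by
    rintro rfl
    refine hnph (hP.isPluriharmonic_of_circleAverage_eq fun w => ?_)
    have hconst (z) : P z = P 0 := by simpa using (hP.map_real_smul 0 z).symm
    simp_rw [hconst, Real.circleAverage_const]
  have hU := isHomogeneousSubmean_rotationAverage hd hPc hP.map_real_smul hpsh.le_circleAverage
    hP.exists_lipschitz
  obtain ⟨w, hw⟩ : ∃ w, rotationAverage P w ≠ 0 := by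
    by_contra! h0
    exact hnph (hP.isPluriharmonic_of_circleAverage_eq fun w =>
      circleAverage_eq_of_rotationAverage_eq_zero hPc hpsh.le_circleAverage h0 w)
  have hP0 : P 0 = 0 := by simpa [hd] using hP.map_real_smul 0 0
  refine (hU.finite_hyperplanes hd hw).subset fun H hH => ⟨by simpa using hH.1, fun z hz => ?_⟩
  rw [rotationAverage_eq_of_isPluriharmonicAlong hH.2 hz, hP0]
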